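/- Let $\mathbb N=\{0,1,2,\dots\}$, let $(c_n)_{n\in\mathbb N}$ be a sequence of complex numbers, and let $L^2[0,1]$ be the complex $L^2$-space of Lebesgue measure on $[0,1]$. An infinite matrix is called positive semidefinite if it is Hermitian and its quadratic form is non-negative on all finitely supported vectors. (i) The map $x^n\mapsto c_n x^n$ ($n\in\mathbb N$) extends to a bounded linear operator $T:L^2[0,1]\to L^2[0,1]$ with $\|T\|\le 1$ if and only if the infinite matrix $$\left[\frac{1-c_m\overline{c_n}}{1+m+n}\right]_{m,n\in\mathbb N}$$ is positive semidefinite. (ii) The map $x^n\mapsto c_n x^n$ ($n\in\mathbb N$) extends to a bounded linear operator on $L^2[0,1]$ if and only if there is a real number $M>0$ such that the matrix in (i) with $c_n/M$ in place of $c_n$ for all $n$, namely $\left[\frac{1-M^{-2}c_m\overline{c_n}}{1+m+n}\right]_{m,n\in\mathbb N}$, is positive semidefinite. (iii) If $T$ is a bounded linear operator on $L^2[0,1]$ with $Tx^n=c_nx^n$ for all $n\in\mathbb N$ and $T\ne 0$, then $T$ is not compact. -/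

import Mathlib

open MeasureTheory
open scoped ComplexOrder

/-- Lebesgue measure on the interval `[0,1]`, as a measure on the real line. -/
noncomputable abbrev unitMeasure : Measure ℝ := volume.restrict (Set.Icc (0 : ℝ) 1)

/-- The complex Hilbert space `L²[0,1]`. -/
noncomputable abbrev L2unit : Type := Lp ℂ 2 unitMeasure

theorem memLp_monomial (n : ℕ) : MemLp (fun x : ℝ => (x : ℂ) ^ n) 2 unitMeasure := by
  refine MemLp.of_bound (C := 1) ?_ ?_
  · exact (by fun_prop : Continuous fun x : ℝ => (x : ℂ) ^ n).aestronglyMeasurable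
  · filter_upwards [ae_restrict_mem measurableSet_Icc] with x hx
    rw [norm_pow, Complex.norm_real, Real.norm_of_nonneg hx.1]
    exact pow_le_one₀ hx.1 hx.2

/-- The monomial `x ^ n` as an element of `L²[0,1]`. -/
noncomputable def monomialL2 (n : ℕ) : L2unit := (memLp_monomial n).toLp

/-- The bounded operator `T` on `L²[0,1]` extends the map `x ^ n ↦ c n * x ^ n`, `n = 0, 1, 2, …`. -/
def ExtendsDiagonal (c : ℕ → ℂ) (T : L2unit →L[ℂ] L2unit) : Prop :=
  ∀ n : ℕ, T (monomialL2 n) = c n • monomialL2 n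

/-- The infinite Pick matrix with entries `(1 - c m * conj (c n)) / (1 + m + n)`. Mathlib's
`Matrix.PosSemidef` for an infinite index type is tested on finitely supported vectors. -/
noncomputable def pickMatrix (c : ℕ → ℂ) : Matrix ℕ ℕ ℂ :=
  Matrix.of fun m n => (1 - c m * star (c n)) / (1 + (m : ℂ) + (n : ℂ))

open Filter Topology

/-! The Gram matrix of the monomials is `1 / (1 + m + n)`, so the quadratic form of the Pick matrix
is `‖p‖² - ‖Tp‖²` for polynomials `p`. Its positivity is contractivity of `T` on polynomials, which
are dense; scaling gives the boundedness criterion. For non-compactness, the dilations `U_a h = √a *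
h (a * ·)`, `0 < a ≤ 1`, are contractions, diagonal on monomials, hence commute with `T`, and tend
strongly to `0` as `a → 0`. Yet `x ^ n = U_a u_a` with `‖u_a‖ ≤ 1`. If `T` is compact, `T u_a → y`
along a subsequence, so `T x ^ n = U_a (T u_a)` has the same limit as `U_a y`, namely `0`. -/

theorem inner_monomialL2 (m n : ℕ) :
    inner ℂ (monomialL2 m) (monomialL2 n) = 1 / (1 + (m : ℂ) + (n : ℂ)) := by
  have h : inner ℂ (monomialL2 m) (monomialL2 n) =
      ∫ x in Set.Icc (0 : ℝ) 1, ((x ^ (m + n) : ℝ) : ℂ) := by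
    rw [L2.inner_def]
    refine integral_congr_ae ?_
    filter_upwards [(memLp_monomial m).coeFn_toLp, (memLp_monomial n).coeFn_toLp] with x hm hn
    rw [monomialL2, monomialL2, hm, hn]
    simp [pow_add, mul_comm]
  rw [h, integral_complex_ofReal, integral_Icc_eq_integral_Ioc,
    ← intervalIntegral.integral_of_le zero_le_one, integral_pow]
  push_cast
  simp
  ring

/-! ### Density of polynomials -/

theorem polynomial_toLp_mem_span (p : Polynomial ℂ) :
    ∃ hp : MemLp (fun x : ℝ => p.eval (x : ℂ)) 2 unitMeasure,
      hp.toLp ∈ Submodule.span ℂ (Set.range monomialL2) := by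
  induction p using Polynomial.induction_on' with
  | add p q hp hq =>
    obtain ⟨hp, hp'⟩ := hp
    obtain ⟨hq, hq'⟩ := hq
    refine ⟨by simpa using! hp.add hq, ?_⟩
    convert! add_mem hp' hq' using 1
    rw [← MemLp.toLp_add]
    exact MemLp.toLp_congr _ _ (.of_forall fun x => by simp)
  | monomial n a =>
    refine ⟨by simpa using! (memLp_monomial n).const_mul a, ?_⟩
    convert! Submodule.smul_mem _ a (Submodule.subset_span (Set.mem_range_self n)) using 1
    rw [monomialL2, ← MemLp.toLp_const_smul]
    exact MemLp.toLp_congr _ _ (.of_forall fun x => by simp)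

theorem exists_complex_polynomial_near {f : ℝ → ℂ} (hf : Continuous f) {ε : ℝ} (hε : 0 < ε) :
    ∃ p : Polynomial ℂ, ∀ x ∈ Set.Icc (0 : ℝ) 1, ‖f x - p.eval (x : ℂ)‖ ≤ ε := by
  obtain ⟨p, hp⟩ := exists_polynomial_near_of_continuousOn 0 1 (fun x => (f x).re)
    (by fun_prop) (ε / 2) (half_pos hε)
  obtain ⟨q, hq⟩ := exists_polynomial_near_of_continuousOn 0 1 (fun x => (f x).im)
    (by fun_prop) (ε / 2) (half_pos hε)
  refine ⟨p.map Complex.ofRealHom + Polynomial.C Complex.I * q.map Complex.ofRealHom,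
    fun x hx => ?_⟩
  have hr (r : Polynomial ℝ) : (r.map Complex.ofRealHom).eval (x : ℂ) = ((r.eval x : ℝ) : ℂ) := by
    simpa using Polynomial.eval_map_apply (f := Complex.ofRealHom) (p := r) x
  rw [Polynomial.eval_add, Polynomial.eval_mul, Polynomial.eval_C, hr, hr]
  refine (Complex.norm_le_abs_re_add_abs_im _).trans ?_
  have h1 := hp x hx
  have h2 := hq x hx
  rw [abs_sub_comm] at h1 h2
  simp
  linarith

theorem topologicalClosure_span_monomialL2 :
    (Submodule.span ℂ (Set.range monomialL2)).topologicalClosure = ⊤ := by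
  rw [eq_top_iff]
  rintro f -
  refine (Submodule.isClosed_topologicalClosure _).closure_subset_iff.2 ?_
    (BoundedContinuousFunction.toLp_denseRange ℂ unitMeasure ℂ (p := 2) (by simp) f)
  rintro _ ⟨g, rfl⟩
  refine Metric.mem_closure_iff.2 fun ε hε => ?_
  obtain ⟨p, hp⟩ := exists_complex_polynomial_near g.continuous (half_pos hε)
  obtain ⟨hmem, hspan⟩ := polynomial_toLp_mem_span p
  refine ⟨_, hspan, ?_⟩
  rw [dist_eq_norm]
  refine lt_of_le_of_lt (Lp.norm_le_of_ae_bound (C := ε / 2) (half_pos hε).le ?_) ?_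
  · filter_upwards [Lp.coeFn_sub (BoundedContinuousFunction.toLp 2 unitMeasure ℂ g) hmem.toLp,
      BoundedContinuousFunction.coeFn_toLp (p := 2) (μ := unitMeasure) (𝕜 := ℂ) g,
      hmem.coeFn_toLp,
      ae_restrict_mem measurableSet_Icc] with x h1 h2 h3 hx
    rw [h1, Pi.sub_apply, h2, h3]
    exact hp x hx
  -- Total mass one: the uniform bound `ε / 2` is also an `L²` bound.
  · have : measureUnivNNReal unitMeasure = 1 := by simp [measureUnivNNReal]
    rw [this]
    simp
    linarith

theorem denseRange_linearCombination_monomialL2 :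
    DenseRange (Finsupp.linearCombination ℂ monomialL2) := by
  have h := (Submodule.dense_iff_topologicalClosure_eq_top).2 topologicalClosure_span_monomialL2
  rw [← Finsupp.range_linearCombination] at h
  simpa [DenseRange] using! h

theorem ext_monomialL2 {S T : L2unit →L[ℂ] L2unit}
    (h : ∀ n, S (monomialL2 n) = T (monomialL2 n)) : S = T :=
  ContinuousLinearMap.ext_on
    (Submodule.dense_iff_topologicalClosure_eq_top.2 topologicalClosure_span_monomialL2)
    (by rintro _ ⟨n, rfl⟩; exact h n)

/-! ### Pick matrix and contractivity -/

/-- The row index carries both `star xi` and the unconjugated `c i`, so the vectors have conjugated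
coefficients. -/
theorem pickMatrix_quadraticForm (c : ℕ → ℂ) (x : ℕ →₀ ℂ) :
    (x.sum fun i xi => x.sum fun j xj => star xi * pickMatrix c i j * xj) =
      ((‖x.sum fun i xi => star xi • monomialL2 i‖ ^ 2 -
        ‖x.sum fun i xi => (star xi * c i) • monomialL2 i‖ ^ 2 : ℝ) : ℂ) := by
  have key (b : ℕ → ℂ) : ((‖x.sum fun i xi => (star xi * b i) • monomialL2 i‖ ^ 2 : ℝ) : ℂ) =
      x.sum fun i xi => x.sum fun j xj =>
        star xi * (b i * star (b j) / (1 + (i : ℂ) + (j : ℂ))) * xj := by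
    push_cast
    rw [← RCLike.ofReal_eq_complex_ofReal, ← inner_self_eq_norm_sq_to_K (𝕜 := ℂ)]
    simp only [Finsupp.sum, sum_inner, inner_sum, inner_smul_left, inner_smul_right,
      inner_monomialL2, Finset.mul_sum]
    refine Finset.sum_congr rfl fun i _ => Finset.sum_congr rfl fun j _ => ?_
    simp
    ring
  have h1 := key fun _ => 1
  have h2 := key c
  simp only [mul_one] at h1
  rw [Complex.ofReal_sub, h1, h2]
  simp only [Finsupp.sum, ← Finset.sum_sub_distrib]
  refine Finset.sum_congr rfl fun i _ => Finset.sum_congr rfl fun j _ => ?_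
  simp [pickMatrix]
  ring

theorem pickMatrix_isHermitian (c : ℕ → ℂ) : (pickMatrix c).IsHermitian := by
  ext i j
  simp [pickMatrix, Matrix.conjTranspose_apply]
  ring

theorem posSemidef_pickMatrix_iff (c : ℕ → ℂ) :
    (pickMatrix c).PosSemidef ↔ ∀ x : ℕ →₀ ℂ,
      ‖Finsupp.linearCombination ℂ (fun n => c n • monomialL2 n) x‖ ≤
        ‖Finsupp.linearCombination ℂ monomialL2 x‖ := by
  have hstar (x : ℕ →₀ ℂ) (v : ℕ → L2unit) :
      (x.sum fun i xi => star xi • v i) =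
        Finsupp.linearCombination ℂ v (x.mapRange star (star_zero ℂ)) := by
    rw [Finsupp.linearCombination_apply, Finsupp.sum_mapRange_index (by simp)]
  have hq (x : ℕ →₀ ℂ) :
      (0 ≤ x.sum fun i xi => x.sum fun j xj => star xi * pickMatrix c i j * xj) ↔
      ‖Finsupp.linearCombination ℂ (fun n => c n • monomialL2 n) (x.mapRange star (star_zero ℂ))‖ ≤
        ‖Finsupp.linearCombination ℂ monomialL2 (x.mapRange star (star_zero ℂ))‖ := by
    rw [pickMatrix_quadraticForm, Complex.zero_le_real, sub_nonneg,
      sq_le_sq₀ (norm_nonneg _) (norm_nonneg _), ← hstar, ← hstar]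
    simp only [smul_smul]
  refine ⟨fun h x => ?_, fun h => ⟨pickMatrix_isHermitian c, fun x => (hq x).2 (h _)⟩⟩
  have hx := (hq (x.mapRange star (star_zero ℂ))).1 (h.2 _)
  have : (x.mapRange star (star_zero ℂ)).mapRange star (star_zero ℂ) = x := by
    ext i
    simp
  rwa [this] at hx

theorem ExtendsDiagonal.apply_linearCombination {c : ℕ → ℂ} {T : L2unit →L[ℂ] L2unit}
    (hT : ExtendsDiagonal c T) (x : ℕ →₀ ℂ) :
    T (Finsupp.linearCombination ℂ monomialL2 x) =
      Finsupp.linearCombination ℂ (fun n => c n • monomialL2 n) x := by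
  simp only [Finsupp.linearCombination_apply, map_finsuppSum, map_smul, hT _]

theorem exists_extendsDiagonal_norm_le_one_iff (c : ℕ → ℂ) :
    (∃ T : L2unit →L[ℂ] L2unit, ExtendsDiagonal c T ∧ ‖T‖ ≤ 1) ↔ (pickMatrix c).PosSemidef := by
  rw [posSemidef_pickMatrix_iff]
  constructor
  · rintro ⟨T, hT, h1⟩ x
    rw [← hT.apply_linearCombination]
    simpa using T.le_of_opNorm_le h1 _
  · intro h
    have hd := denseRange_linearCombination_monomialL2
    -- The norm inequality makes the map on polynomials well defined and continuous, so it extends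
    -- by density.
    refine ⟨(Finsupp.linearCombination ℂ fun n => c n • monomialL2 n).extendOfNorm
      (Finsupp.linearCombination ℂ monomialL2), fun n => ?_,
      LinearMap.opNorm_extendOfNorm_le hd zero_le_one (by simpa using h)⟩
    have := LinearMap.extendOfNorm_eq hd ⟨1, by simpa using h⟩ (Finsupp.single n 1)
    simpa using this

theorem ExtendsDiagonal.smul {c : ℕ → ℂ} {T : L2unit →L[ℂ] L2unit} (hT : ExtendsDiagonal c T)
    (a : ℂ) : ExtendsDiagonal (fun n => a * c n) (a • T) := fun n => by
  rw [smul_apply, hT n, smul_smul]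

theorem exists_extendsDiagonal_iff (c : ℕ → ℂ) :
    (∃ T : L2unit →L[ℂ] L2unit, ExtendsDiagonal c T) ↔
      ∃ M : ℝ, 0 < M ∧ (pickMatrix fun n => c n / (M : ℂ)).PosSemidef := by
  simp only [← exists_extendsDiagonal_norm_le_one_iff]
  constructor
  · rintro ⟨T, hT⟩
    -- The added `1` keeps `M` positive when `T = 0`.
    have hM : 0 < ‖T‖ + 1 := by positivity
    refine ⟨‖T‖ + 1, hM, ((‖T‖ + 1 : ℝ) : ℂ)⁻¹ • T, ?_, ?_⟩
    · simpa only [div_eq_inv_mul] using hT.smul _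
    · rw [norm_smul, norm_inv, Complex.norm_real, Real.norm_of_nonneg hM.le, inv_mul_le_one₀ hM]
      linarith
  · rintro ⟨M, hM, T, hT, -⟩
    refine ⟨(M : ℂ) • T, ?_⟩
    have hM' : (M : ℂ) ≠ 0 := by exact_mod_cast hM.ne'
    simpa only [mul_div_cancel₀ _ hM'] using hT.smul (M : ℂ)


/-! ### Dilations -/

/-- The image measure is `a⁻¹` times Lebesgue measure on `[0,a] ⊆ [0,1]`. -/
theorem map_mul_left_unitMeasure_le {a : ℝ} (ha : 0 < a) (ha1 : a ≤ 1) :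
    unitMeasure.map (a * ·) ≤ ENNReal.ofReal a⁻¹ • unitMeasure := by
  have hpre : (a * ·) ⁻¹' Set.Icc 0 a = Set.Icc (0 : ℝ) 1 := by
    ext x
    simp [ha, div_self ha.ne']
  rw [unitMeasure, ← hpre, ← Measure.restrict_map (by fun_prop) measurableSet_Icc,
    Real.map_volume_mul_left ha.ne', abs_of_pos (inv_pos.2 ha), Measure.restrict_smul, hpre]
  gcongr

theorem eLpNorm_comp_mul_left_le {a : ℝ} (ha : 0 < a) (ha1 : a ≤ 1) {f : ℝ → ℂ}
    (hf : AEStronglyMeasurable f unitMeasure) :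
    eLpNorm (fun x => (√a : ℂ) * f (a * x)) 2 unitMeasure ≤ eLpNorm f 2 unitMeasure := by
  have hle := map_mul_left_unitMeasure_le ha ha1
  have hm : AEStronglyMeasurable f (unitMeasure.map (a * ·)) :=
    (hf.smul_measure _).mono_measure hle
  calc eLpNorm (fun x => (√a : ℂ) * f (a * x)) 2 unitMeasure
      = ‖(√a : ℂ)‖ₑ * eLpNorm (f ∘ (a * ·)) 2 unitMeasure :=
        eLpNorm_const_smul (√a : ℂ) (f ∘ (a * ·)) 2 unitMeasure
    _ = ‖(√a : ℂ)‖ₑ * eLpNorm f 2 (unitMeasure.map (a * ·)) := by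
        rw [eLpNorm_map_measure hm (by fun_prop)]
    _ ≤ ‖(√a : ℂ)‖ₑ * eLpNorm f 2 (ENNReal.ofReal a⁻¹ • unitMeasure) := by
        gcongr
    _ = ‖(√a : ℂ)‖ₑ * ENNReal.ofReal a⁻¹ ^ (1 / 2 : ℝ) * eLpNorm f 2 unitMeasure := by
        rw [eLpNorm_smul_measure_of_ne_top (by simp), mul_assoc]
        simp
    _ = eLpNorm f 2 unitMeasure := by
        have : ‖(√a : ℂ)‖ₑ = ENNReal.ofReal √a := by
          rw [← ofReal_norm, Complex.norm_real, Real.norm_of_nonneg (Real.sqrt_nonneg a)]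
        rw [this, ENNReal.ofReal_rpow_of_nonneg (inv_pos.2 ha).le (by norm_num),
          ← ENNReal.ofReal_mul (Real.sqrt_nonneg a), ← Real.sqrt_eq_rpow, Real.sqrt_inv,
          mul_inv_cancel₀ (Real.sqrt_pos.2 ha).ne']
        simp

/-- The normalised dilation `h ↦ √a * h (a * ·)` is a contraction of `L²[0,1]`. -/
theorem exists_dilation {a : ℝ} (ha : 0 < a) (ha1 : a ≤ 1) :
    ∃ U : L2unit →L[ℂ] L2unit, (∀ h, ‖U h‖ ≤ ‖h‖) ∧
      ∀ f (hf : MemLp f 2 unitMeasure),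
        U hf.toLp =ᵐ[unitMeasure] fun x => (√a : ℂ) * f (a * x) := by
  have hqmp : Measure.QuasiMeasurePreserving (a * ·) unitMeasure unitMeasure :=
    ⟨by fun_prop, (map_mul_left_unitMeasure_le ha ha1).absolutelyContinuous.trans
      Measure.smul_absolutelyContinuous⟩
  have hmem (h : L2unit) : MemLp (fun x => (√a : ℂ) * h (a * x)) 2 unitMeasure :=
    ⟨((Lp.aestronglyMeasurable h).comp_quasiMeasurePreserving hqmp).const_mul _,
      (eLpNorm_comp_mul_left_le ha ha1 (Lp.aestronglyMeasurable h)).trans_lt (Lp.eLpNorm_lt_top h)⟩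
  let L : L2unit →ₗ[ℂ] L2unit :=
    { toFun := fun h => (hmem h).toLp
      map_add' := fun f g => by
        rw [← MemLp.toLp_add]
        refine MemLp.toLp_congr _ _ ?_
        filter_upwards [hqmp.ae (Lp.coeFn_add f g)] with x hx
        simp only [Pi.add_apply, hx, mul_add]
      map_smul' := fun c f => by
        rw [RingHom.id_apply, ← MemLp.toLp_const_smul]
        refine MemLp.toLp_congr _ _ ?_
        filter_upwards [hqmp.ae (Lp.coeFn_smul c f)] with x hx
        simp only [Pi.smul_apply, hx, smul_eq_mul, mul_left_comm] }
  have hL (h : L2unit) : ‖L h‖ ≤ ‖h‖ := by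
    change ‖(hmem h).toLp‖ ≤ _
    rw [Lp.norm_toLp, Lp.norm_def]
    exact ENNReal.toReal_mono (Lp.eLpNorm_ne_top h)
      (eLpNorm_comp_mul_left_le ha ha1 (Lp.aestronglyMeasurable h))
  refine ⟨L.mkContinuous 1 (by simpa using hL), fun h => hL h, fun f hf => ?_⟩
  change (hmem hf.toLp).toLp =ᵐ[unitMeasure] _
  filter_upwards [(hmem hf.toLp).coeFn_toLp, hqmp.ae hf.coeFn_toLp] with x h1 h2
  rw [h1, h2]

theorem exists_dilation_sequence (n : ℕ) :
    ∃ (U : ℕ → L2unit →L[ℂ] L2unit) (u : ℕ → L2unit) (a : ℕ → ℝ),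
      Tendsto a atTop (𝓝 0) ∧ (∀ k h, ‖U k h‖ ≤ ‖h‖) ∧
      (∀ k m, U k (monomialL2 m) = ((√(a k) : ℂ) * (a k : ℂ) ^ m) • monomialL2 m) ∧
      ∀ k, ‖u k‖ ≤ 1 ∧ U k (u k) = monomialL2 n := by
  have main {a : ℝ} (ha : 0 < a) (ha1 : a ≤ 1) :
      ∃ (U : L2unit →L[ℂ] L2unit) (u : L2unit), (∀ h, ‖U h‖ ≤ ‖h‖) ∧
        (∀ m, U (monomialL2 m) = ((√a : ℂ) * (a : ℂ) ^ m) • monomialL2 m) ∧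
        ‖u‖ ≤ 1 ∧ U u = monomialL2 n := by
    obtain ⟨U, hU, hUf⟩ := exists_dilation ha ha1
    have hs : 0 < √a := Real.sqrt_pos.2 ha
    -- The preimage of `x ^ n` under the dilation, squeezed into `[0,a]`: its supremum is at most `1
    -- / √a` on a set of measure `a`, so its norm is at most `1`.
    let f : ℝ → ℂ := (Set.Icc 0 a).indicator fun x => (√a : ℂ)⁻¹ * ((x / a : ℝ) : ℂ) ^ n
    have hfm : AEStronglyMeasurable f unitMeasure :=
      ((by fun_prop : Continuous fun x : ℝ =>
        (√a : ℂ)⁻¹ * ((x / a : ℝ) : ℂ) ^ n).aestronglyMeasurable).indicator measurableSet_Icc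
    have hfn : eLpNorm f 2 unitMeasure ≤ 1 := by
      have hb : ∀ᵐ x ∂unitMeasure.restrict (Set.Icc 0 a),
          ‖(√a : ℂ)⁻¹ * ((x / a : ℝ) : ℂ) ^ n‖ ≤ (√a)⁻¹ := by
        filter_upwards [ae_restrict_mem measurableSet_Icc] with x hx
        have h0 : 0 ≤ x / a := div_nonneg hx.1 ha.le
        rw [norm_mul, norm_inv, norm_pow, Complex.norm_real, Complex.norm_real,
          Real.norm_of_nonneg hs.le, Real.norm_of_nonneg h0]
        exact mul_le_of_le_one_right (inv_pos.2 hs).le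
          (pow_le_one₀ h0 ((div_le_one ha).2 hx.2))
      rw [eLpNorm_indicator_eq_eLpNorm_restrict measurableSet_Icc]
      refine (eLpNorm_le_of_ae_bound hb).trans ?_
      rw [Measure.restrict_restrict measurableSet_Icc,
        Set.inter_eq_left.2 (Set.Icc_subset_Icc_right ha1), Measure.restrict_apply_univ,
        Real.volume_Icc, sub_zero, ENNReal.toReal_ofNat,
        ENNReal.ofReal_rpow_of_nonneg ha.le (by norm_num), inv_eq_one_div (2 : ℝ),
        ← Real.sqrt_eq_rpow, ← ENNReal.ofReal_mul hs.le, mul_inv_cancel₀ hs.ne']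
      simp
    have hf : MemLp f 2 unitMeasure := ⟨hfm, hfn.trans_lt ENNReal.one_lt_top⟩
    refine ⟨U, hf.toLp, hU, fun m => ?_, ?_, ?_⟩
    · refine Lp.ext ?_
      filter_upwards [hUf _ (memLp_monomial m), (memLp_monomial m).coeFn_toLp,
        Lp.coeFn_smul ((√a : ℂ) * (a : ℂ) ^ m) (monomialL2 m)] with x h1 h2 h3
      rw [h3, monomialL2, h1, Pi.smul_apply, h2]
      simp [mul_pow, mul_assoc]
    · rw [Lp.norm_toLp]
      exact ENNReal.toReal_le_of_le_ofReal zero_le_one (by simpa using hfn)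
    · refine Lp.ext ?_
      filter_upwards [hUf _ hf, (memLp_monomial n).coeFn_toLp,
        ae_restrict_mem measurableSet_Icc] with x h1 h2 hx
      have hax : a * x ∈ Set.Icc 0 a :=
        ⟨mul_nonneg ha.le hx.1, mul_le_of_le_one_right ha.le hx.2⟩
      have hs' : (√a : ℂ) ≠ 0 := by exact_mod_cast hs.ne'
      rw [h1, monomialL2, h2]
      simp only [f, Set.indicator_of_mem hax]
      rw [mul_inv_cancel_left₀ hs', mul_div_cancel_left₀ _ ha.ne']
  have ha (k : ℕ) : 0 < 1 / ((k : ℝ) + 1) := Nat.one_div_pos_of_nat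
  have ha1 (k : ℕ) : 1 / ((k : ℝ) + 1) ≤ 1 := by
    rw [div_le_one (by positivity)]
    linarith [k.cast_nonneg (α := ℝ)]
  choose U u h1 h2 h3 h4 using fun k => main (ha k) (ha1 k)
  exact ⟨U, u, _, tendsto_one_div_add_atTop_nhds_zero_nat, h1, h2, fun k => ⟨h3 k, h4 k⟩⟩

/-- Strong convergence to zero of a sequence of contractions can be tested on monomials. -/
theorem tendsto_zero_of_monomialL2 {U : ℕ → L2unit →L[ℂ] L2unit} (hU : ∀ k h, ‖U k h‖ ≤ ‖h‖)
    (h0 : ∀ m, Tendsto (fun k => U k (monomialL2 m)) atTop (𝓝 0)) (y : L2unit) :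
    Tendsto (fun k => U k y) atTop (𝓝 0) := by
  have hpoly (x : ℕ →₀ ℂ) :
      Tendsto (fun k => U k (Finsupp.linearCombination ℂ monomialL2 x)) atTop (𝓝 0) := by
    simp only [Finsupp.linearCombination_apply, Finsupp.sum]
    simpa using tendsto_finsetSum x.support fun m _ => (h0 m).const_smul (x m)
  rw [Metric.tendsto_atTop]
  intro ε hε
  obtain ⟨x, hx⟩ := denseRange_linearCombination_monomialL2.exists_dist_lt y (half_pos hε)
  obtain ⟨N, hN⟩ := Metric.tendsto_atTop.1 (hpoly x) (ε / 2) (half_pos hε)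
  refine ⟨N, fun k hk => ?_⟩
  have h1 := hN k hk
  have h2 := hU k (y - Finsupp.linearCombination ℂ monomialL2 x)
  rw [dist_eq_norm] at hx
  rw [dist_zero_right] at h1 ⊢
  rw [map_sub] at h2
  linarith [norm_le_norm_sub_add (U k y) (U k (Finsupp.linearCombination ℂ monomialL2 x))]

/-! ### Non-compactness -/

theorem ExtendsDiagonal.eq_zero_of_isCompactOperator {c : ℕ → ℂ} {T : L2unit →L[ℂ] L2unit}
    (hT : ExtendsDiagonal c T) (hc : IsCompactOperator T) : T = 0 := by
  refine ext_monomialL2 fun n => ?_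
  obtain ⟨U, u, a, ha, hU, hUm, hu⟩ := exists_dilation_sequence n
  have hcomm (k : ℕ) (h : L2unit) : U k (T h) = T (U k h) := by
    have : (U k).comp T = T.comp (U k) := ext_monomialL2 fun m => by
      simp [hT m, hUm k m, smul_comm (c m)]
    exact DFunLike.congr_fun this h
  have hU0 (y : L2unit) : Tendsto (fun k => U k y) atTop (𝓝 0) := by
    refine tendsto_zero_of_monomialL2 hU (fun m => ?_) y
    simp only [hUm]
    have hcont : Continuous fun t : ℝ => ((√t : ℂ) * (t : ℂ) ^ m) • monomialL2 m := by fun_prop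
    simpa [Function.comp_def] using (hcont.tendsto 0).comp ha
  obtain ⟨K, hK, hTK⟩ := IsCompactOperator.image_closedBall_subset_compact
    (f := (T : L2unit →ₗ[ℂ] L2unit)) hc 1
  obtain ⟨y, -, φ, hφ, hy⟩ := hK.tendsto_subseq (x := fun k => T (u k))
    fun k => hTK ⟨u k, by simpa using (hu k).1, rfl⟩
  have hconst (k : ℕ) : U (φ k) (T (u (φ k))) = T (monomialL2 n) := by
    rw [hcomm, (hu _).2]
  -- Uniform contractivity lets the moving vector `T (u (φ k))` be replaced by its limit `y`.
  have hdiff : Tendsto (fun k => U (φ k) (T (u (φ k)) - y)) atTop (𝓝 0) :=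
    squeeze_zero_norm (fun k => hU _ _) (by simpa using (hy.sub_const y).norm)
  have hsum := hdiff.add ((hU0 y).comp hφ.tendsto_atTop)
  simp only [map_sub, Function.comp_def, sub_add_cancel, hconst, add_zero] at hsum
  exact tendsto_nhds_unique tendsto_const_nhds hsum

theorem theorem3p2 (c : ℕ → ℂ) :
    ((∃ T : L2unit →L[ℂ] L2unit, ExtendsDiagonal c T ∧ ‖T‖ ≤ 1) ↔ (pickMatrix c).PosSemidef) ∧
    ((∃ T : L2unit →L[ℂ] L2unit, ExtendsDiagonal c T) ↔
      ∃ M : ℝ, 0 < M ∧ (pickMatrix fun n => c n / (M : ℂ)).PosSemidef) ∧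
    (∀ T : L2unit →L[ℂ] L2unit, ExtendsDiagonal c T → T ≠ 0 → ¬ IsCompactOperator T) :=
  ⟨exists_extendsDiagonal_norm_le_one_iff c, exists_extendsDiagonal_iff c,
    fun _ hT h0 hc => h0 (hT.eq_zero_of_isCompactOperator hc)⟩
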